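/- Let $\mathcal E=\mathrm{Sh}(C,J)$ be the topos of sheaves on a site. "Set" below means object of $\mathcal E$, "element" means generalized element (an element of a sheaf at some stage $c\in C$), and all statements about elements are read in the internal language of $\mathcal E$ (Kripke–Joyal semantics; in particular "there exists" means existence locally, on a covering sieve). **Setting.** Let $R$ be a commutative ring object in $\mathcal E$ containing $\mathbb Q$. For $k,n\ge 0$ put $$D_k(n)=\{d\in R^n : \text{every product of } k+1 \text{ coordinates of } d \text{ (repetitions allowed) is } 0\},\qquad D(n)=D_1(n).$$ An $R$-module $W$ is called KL if for all $k,n\geq 0$ every map $D_k(n)\to W$ is given by $d\mapsto \sum_{|\alpha|\le k} d^{\alpha}a_\alpha$ for unique coefficients $a_\alpha\in W$. Assume that $R$ itself is KL (the Kock–Lawvere axiom). A map $p:X\to Y$ is formally étale if for each $D=D_k(n)$ the square formed by $p^D:X^D\to Y^D$, $p:X\to Y$ and the evaluations at $0\in D$ is a pullback. A chart of $M$ is an object $U$ with a formally étale monomorphism $U\to M$ and a formally étale monomorphism $U\to R^n$, for some $n$. A formal manifold is an object $M$ that is covered by its charts. For $x,y\in M$ write $x\sim y$ if there is a chart containing $x$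 and $y$ in which the difference of the coordinate vectors of $y$ and $x$ belongs to $D(n)$. For $x\in M$, the $\infty$-monad $\mathfrak M_\infty(x)$ is the set of those $y\in M$ for which there are some $n\in\mathbb N$ and a path $x=x_0\sim x_1\sim\dots\sim x_n=y$ in $M$. Let $(G,*,1)$ be a group in $\mathcal E$ that is a matrix group: there is an associative unital $R$-algebra $W$ whose underlying $R$-module is KL and such that $G$ is isomorphic to a subgroup of the multiplicative monoid of $W$. A $G$-valued 1-form on $M$ is a map $\omega$ assigning to each pair $x\sim y$ in $M$ an element $\omega(x,y)\in G$, with $\omega(x,x)=1$ and $\omega(y,x)=\omega(x,y)^{-1}$. It is closed if $\omega(x,y)*\omega(y,z)=\omega(x,z)$ whenever $x,y,z\in M$ are mutual neighbours, that is, $x\sim y$, $y\sim z$ and $x\sim z$. For $U\subseteq M$, a map $f:U\to G$ is a (partial) primitive of $\omega$ on $U$ if $f(x)^{-1}*f(y)=\omega(x,y)$ for all $x,y\in U$ with $x\sim y$. **Corollary.** Let $M$ be a formal manifold, $G$ a matrix group as above and $\omega$ a closed $G$-valued 1-form on $M$. Then for each $x_0\in M$ (at any stage) there exists a unique partial primitive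 $f:\mathfrak M_\infty(x_0)\to G$ of $\omega$ with $f(x_0)=1$. -/

import Mathlib

open CategoryTheory Opposite

universe w v u

/-!
Synthetic differential geometry, interpreted in the Grothendieck topos of sheaves on a site
`(C, J)`.  Objects of the topos are functors `X : Cᵒᵖ ⥤ Type w` that are sheaves for `J`; a
(generalized) element of `X` at stage `c : C` is an element of `X.obj (op c)`, and its restriction
along `f : d ⟶ c` is `X.map f.op x`.  All formulas are spelled out by the Kripke-Joyal semantics:
quantifiers `∀` range over generalized elements at all later stages, and `∃` means existence on
a covering sieve.
-/

namespace SDG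

variable {C : Type u} [Category.{v} C]

/-- A subobject of `X` in the slice over the stage `c`. -/
structure StageSub (X : Cᵒᵖ ⥤ Type w) (c : C) where
  mem : ∀ ⦃d : C⦄, (d ⟶ c) → X.obj (op d) → Prop
  map_mem : ∀ ⦃d e : C⦄ (f : d ⟶ c) (g : e ⟶ d) (x : X.obj (op d)),
    mem f x → mem (g ≫ f) (X.map g.op x)

/-- A subobject of `X`, regarded as a subobject over the stage `c`. -/
def StageSub.ofSubfunctor {X : Cᵒᵖ ⥤ Type w} (S : Subfunctor X) (c : C) : StageSub X c where
  mem _ _ x := x ∈ S.obj _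
  map_mem _ _ _ g _ hx := S.map g.op hx

/-- A map `S → Y` over the stage `c`.  When `S` comes from a subobject `S ⊆ X`, this is an element
of the function object `Y ^ S` at stage `c`. -/
@[ext]
structure StageMap {X : Cᵒᵖ ⥤ Type w} {c : C} (S : StageSub X c) (Y : Cᵒᵖ ⥤ Type w) where
  toFun : ∀ ⦃d : C⦄ (f : d ⟶ c) (x : X.obj (op d)), S.mem f x → Y.obj (op d)
  naturality : ∀ ⦃d e : C⦄ (f : d ⟶ c) (g : e ⟶ d) (x : X.obj (op d)) (hx : S.mem f x),
    toFun (g ≫ f) (X.map g.op x) (S.map_mem f g x hx) = Y.map g.op (toFun f x hx)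

/-- The composite of a map over a stage with a map `Y ⟶ Z` of the topos. -/
def StageMap.comp {X Y Z : Cᵒᵖ ⥤ Type w} {c : C} {S : StageSub X c} (F : StageMap S Y)
    (p : Y ⟶ Z) : StageMap S Z where
  toFun _ f x hx := p.app _ (F.toFun f x hx)
  naturality d e f g x hx := by
    rw [F.naturality]
    exact NatTrans.naturality_apply p g.op _

/-! ### The line `R`, its powers and the infinitesimal objects -/

/-- The object `R ^ n`. -/
def pow (R : Cᵒᵖ ⥤ CommRingCat.{w}) (n : ℕ) : Cᵒᵖ ⥤ Type w where
  obj c := Fin n → R.obj c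
  map f := TypeCat.ofHom fun a i => (R.map f).hom (a i)
  map_id _ := by ext a; simp
  map_comp _ _ := by ext a; simp

/-- The coordinates of an element of `R ^ n`. -/
def pow.coord {R : Cᵒᵖ ⥤ CommRingCat.{w}} {n : ℕ} {c : Cᵒᵖ} (a : (pow R n).obj c) (i : Fin n) :
    R.obj c := a i

/-- The origin of `R ^ n`. -/
def pow.origin (R : Cᵒᵖ ⥤ CommRingCat.{w}) (n : ℕ) (c : Cᵒᵖ) : (pow R n).obj c :=
  fun _ => (0 : R.obj c)

/-- The infinitesimal object `D_k(n) ⊆ R ^ n`: the vectors such that the product of any `k + 1` of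
their coordinates (repetitions allowed) is zero. -/
def infinitesimal (R : Cᵒᵖ ⥤ CommRingCat.{w}) (k n : ℕ) : Subfunctor (pow R n) where
  obj _ := {a | ∀ s : Fin (k + 1) → Fin n, ∏ j, pow.coord a (s j) = 0}
  map {c c'} f a ha s := by
    have h := congrArg (R.map f).hom (ha s)
    rw [map_prod, map_zero] at h
    exact h

theorem origin_mem_infinitesimal (R : Cᵒᵖ ⥤ CommRingCat.{w}) (k n : ℕ) (c : Cᵒᵖ) :
    pow.origin R n c ∈ (infinitesimal R k n).obj c := by
  intro s
  exact Finset.prod_eq_zero (Finset.mem_univ 0) rfl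

/-- `D_k(n)` over the stage `c`. -/
abbrev infinitesimalAt (R : Cᵒᵖ ⥤ CommRingCat.{w}) (k n : ℕ) (c : C) : StageSub (pow R n) c :=
  StageSub.ofSubfunctor (infinitesimal R k n) c

/-! ### Algebras and the Kock-Lawvere axiom -/

/-- An associative unital `R`-algebra in the topos (not necessarily commutative): a ring object
with a central homomorphism from `R`.  Its scalar multiplication is `r • a = unit r * a`. -/
structure AlgebraObj (R : Cᵒᵖ ⥤ CommRingCat.{w}) where
  ring : Cᵒᵖ ⥤ RingCat.{w}
  unit : R ⋙ forget₂ CommRingCat RingCat ⟶ ring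
  central : ∀ (c : Cᵒᵖ) (r : R.obj c) (a : ring.obj c), (unit.app c).hom r * a = a * (unit.app c).hom r

/-- The underlying object of an algebra. -/
abbrev AlgebraObj.carrier {R : Cᵒᵖ ⥤ CommRingCat.{w}} (W : AlgebraObj R) : Cᵒᵖ ⥤ Type w :=
  W.ring ⋙ forget RingCat

/-- `R` as an algebra over itself. -/
def AlgebraObj.self (R : Cᵒᵖ ⥤ CommRingCat.{w}) : AlgebraObj R where
  ring := R ⋙ forget₂ CommRingCat RingCat
  unit := 𝟙 _
  central c r a := mul_comm (G := R.obj c) r a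

/-- The exponents of the monomials of degree at most `k` in `n` variables. -/
abbrev Exponent (k n : ℕ) : Type :=
  {α : Fin n → Fin (k + 1) // ∑ i, (α i : ℕ) ≤ k}

/-- The Kock-Lawvere axiom for (the underlying `R`-module of) `W`: for all `k` and `n`, every map
`D_k(n) → W`, at any stage `c`, is given by a unique polynomial of degree at most `k` with
coefficients in `W`. -/
def AlgebraObj.IsKL {R : Cᵒᵖ ⥤ CommRingCat.{w}} (W : AlgebraObj R) : Prop :=
  ∀ (k n : ℕ) (c : C) (F : StageMap (infinitesimalAt R k n c) W.carrier),
    ∃! a : Exponent k n → W.ring.obj (op c),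
      ∀ ⦃d : C⦄ (f : d ⟶ c) (x : (pow R n).obj (op d)) (hx : (infinitesimalAt R k n c).mem f x),
        (F.toFun f x hx : W.ring.obj (op d)) =
          ∑ α : Exponent k n,
            (W.unit.app (op d)).hom (∏ i, pow.coord x i ^ (α.1 i : ℕ) : R.obj (op d)) *
              (W.ring.map f.op).hom (a α)

/-! ### Formal manifolds -/

/-- `p : X ⟶ Y` is formally étale: for each `D = D_k(n)`, the square with sides `X ^ D → Y ^ D`,
`p : X → Y` and evaluation at the origin is a pullback. -/
def IsFormallyEtale (R : Cᵒᵖ ⥤ CommRingCat.{w}) {X Y : Cᵒᵖ ⥤ Type w} (p : X ⟶ Y) : Prop :=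
  ∀ (k n : ℕ) (c : C) (F : StageMap (infinitesimalAt R k n c) Y) (x : X.obj (op c)),
    F.toFun (𝟙 c) (pow.origin R n (op c)) (origin_mem_infinitesimal R k n (op c)) = p.app _ x →
    ∃! F' : StageMap (infinitesimalAt R k n c) X,
      F'.comp p = F ∧
      F'.toFun (𝟙 c) (pow.origin R n (op c)) (origin_mem_infinitesimal R k n (op c)) = x

/-- A coordinate chart of `M`: an object with formally étale monomorphisms to `M` and to
some `R ^ dim`. -/
structure Chart (J : GrothendieckTopology C) (R : Cᵒᵖ ⥤ CommRingCat.{w}) (M : Cᵒᵖ ⥤ Type w) where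
  dim : ℕ
  domain : Cᵒᵖ ⥤ Type w
  isSheaf : Presieve.IsSheaf J domain
  incl : domain ⟶ M
  incl_injective : ∀ c, Function.Injective (incl.app c)
  incl_etale : IsFormallyEtale R incl
  coord : domain ⟶ pow R dim
  coord_injective : ∀ c, Function.Injective (coord.app c)
  coord_etale : IsFormallyEtale R coord

/-- A formal manifold: a sheaf that is covered by its charts. -/
structure IsFormalManifold (J : GrothendieckTopology C) (R : Cᵒᵖ ⥤ CommRingCat.{w})
    (M : Cᵒᵖ ⥤ Type w) : Prop where
  isSheaf : Presieve.IsSheaf J M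
  covered : ∀ (c : C) (x : M.obj (op c)), ∃ S ∈ J c, ∀ ⦃d : C⦄ (f : d ⟶ c), S f →
    ∃ (U : Chart J R M) (u : U.domain.obj (op d)), U.incl.app _ u = M.map f.op x

/-- `x ∼ y`: there is a chart containing `x` and `y` such that
the difference of the coordinates belongs to `D(n) = D_1(n)`. -/
def Nbr (J : GrothendieckTopology C) (R : Cᵒᵖ ⥤ CommRingCat.{w}) {M : Cᵒᵖ ⥤ Type w} {c : C}
    (x y : M.obj (op c)) : Prop :=
  ∃ S ∈ J c, ∀ ⦃d : C⦄ (f : d ⟶ c), S f →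
    ∃ (U : Chart J R M) (a b : U.domain.obj (op d)),
      U.incl.app _ a = M.map f.op x ∧ U.incl.app _ b = M.map f.op y ∧
      (fun i => pow.coord (U.coord.app _ b) i - pow.coord (U.coord.app _ a) i) ∈
        (infinitesimal R 1 U.dim).obj (op d)

theorem Nbr.map {J : GrothendieckTopology C} {R : Cᵒᵖ ⥤ CommRingCat.{w}} {M : Cᵒᵖ ⥤ Type w}
    {c d : C} {x y : M.obj (op c)} (h : Nbr J R x y) (f : d ⟶ c) :
    Nbr J R (M.map f.op x) (M.map f.op y) := by
  obtain ⟨S, hS, H⟩ := h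
  refine ⟨S.pullback f, J.pullback_stable f hS, fun e g hg => ?_⟩
  obtain ⟨U, a, b, ha, hb, hab⟩ := H (g ≫ f) hg
  refine ⟨U, a, b, ?_, ?_, hab⟩
  · rw [ha]; simp
  · rw [hb]; simp

/-- `y` belongs to the `∞`-monad of `x`: for some `n` there is an `n`-path
`x = p 0 ∼ p 1 ∼ ... ∼ p n = y`. -/
def InMonad (J : GrothendieckTopology C) (R : Cᵒᵖ ⥤ CommRingCat.{w}) {M : Cᵒᵖ ⥤ Type w} {c : C}
    (x y : M.obj (op c)) : Prop :=
  ∃ S ∈ J c, ∀ ⦃d : C⦄ (f : d ⟶ c), S f →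
    ∃ (n : ℕ) (p : Fin (n + 1) → M.obj (op d)),
      p 0 = M.map f.op x ∧ p (Fin.last n) = M.map f.op y ∧
      ∀ i : Fin n, Nbr J R (p i.castSucc) (p i.succ)

theorem InMonad.map {J : GrothendieckTopology C} {R : Cᵒᵖ ⥤ CommRingCat.{w}} {M : Cᵒᵖ ⥤ Type w}
    {c d : C} {x y : M.obj (op c)} (h : InMonad J R x y) (f : d ⟶ c) :
    InMonad J R (M.map f.op x) (M.map f.op y) := by
  obtain ⟨S, hS, H⟩ := h
  refine ⟨S.pullback f, J.pullback_stable f hS, fun e g hg => ?_⟩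
  obtain ⟨n, p, h0, h1, hp⟩ := H (g ≫ f) hg
  refine ⟨n, p, ?_, ?_, hp⟩
  · rw [h0]; simp
  · rw [h1]; simp

/-- The `∞`-monad of the element `x` at stage `c`, as a subobject of `M` over the stage `c`. -/
def monad (J : GrothendieckTopology C) (R : Cᵒᵖ ⥤ CommRingCat.{w}) {M : Cᵒᵖ ⥤ Type w} {c : C}
    (x : M.obj (op c)) : StageSub M c where
  mem _ f y := InMonad J R (M.map f.op x) y
  map_mem d e f g y hy := by
    have h := hy.map g
    have e : M.map g.op (M.map f.op x) = M.map (g ≫ f).op x := by simp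
    rwa [e] at h

theorem self_mem_monad (J : GrothendieckTopology C) (R : Cᵒᵖ ⥤ CommRingCat.{w})
    {M : Cᵒᵖ ⥤ Type w} {c : C} (x : M.obj (op c)) : (monad J R x).mem (𝟙 c) x := by
  refine ⟨⊤, J.top_mem c, fun d f _ => ⟨0, fun _ => M.map f.op x, ?_, rfl, fun i => i.elim0⟩⟩
  simp

/-! ### Group valued forms -/

/-- The underlying object of a group object. -/
abbrev groupCarrier (G : Cᵒᵖ ⥤ GrpCat.{w}) : Cᵒᵖ ⥤ Type w := G ⋙ forget GrpCat

/-- `G` is (isomorphic to) a matrix group: a subgroup of the multiplicative monoid of an associative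
unital algebra satisfying the Kock-Lawvere axiom. -/
def IsMatrixGroup (J : GrothendieckTopology C) (R : Cᵒᵖ ⥤ CommRingCat.{w})
    (G : Cᵒᵖ ⥤ GrpCat.{w}) : Prop :=
  ∃ (W : AlgebraObj R) (j : ∀ c : Cᵒᵖ, G.obj c →* W.ring.obj c),
    Presieve.IsSheaf J W.carrier ∧ W.IsKL ∧
    (∀ c, Function.Injective (j c)) ∧
    (∀ ⦃c d : Cᵒᵖ⦄ (f : c ⟶ d) (g : G.obj c), j d ((G.map f).hom g) = (W.ring.map f).hom (j c g))

/-- A `G`-valued 1-form on `M`: a map from `M_(1) = {(x, y) | x ∼ y}` to `G` with `ω(x, x) = 1` and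
`ω(y, x) = ω(x, y)⁻¹`. -/
structure OneForm (J : GrothendieckTopology C) (R : Cᵒᵖ ⥤ CommRingCat.{w}) (M : Cᵒᵖ ⥤ Type w)
    (G : Cᵒᵖ ⥤ GrpCat.{w}) where
  toFun : ∀ ⦃c : C⦄ (x y : M.obj (op c)), Nbr J R x y → G.obj (op c)
  naturality : ∀ ⦃c d : C⦄ (f : d ⟶ c) (x y : M.obj (op c)) (h : Nbr J R x y),
    toFun (M.map f.op x) (M.map f.op y) (h.map f) = (G.map f.op).hom (toFun x y h)
  refl : ∀ ⦃c : C⦄ (x : M.obj (op c)) (h : Nbr J R x x), toFun x x h = 1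
  symm : ∀ ⦃c : C⦄ (x y : M.obj (op c)) (h : Nbr J R x y) (h' : Nbr J R y x),
    toFun y x h' = (toFun x y h)⁻¹

variable {J : GrothendieckTopology C} {R : Cᵒᵖ ⥤ CommRingCat.{w}} {M : Cᵒᵖ ⥤ Type w}
  {G : Cᵒᵖ ⥤ GrpCat.{w}}

/-- `ω` is closed: `ω(x, y) * ω(y, z) = ω(x, z)` whenever `x, y, z` are mutual neighbours. -/
def OneForm.IsClosed (ω : OneForm J R M G) : Prop :=
  ∀ ⦃c : C⦄ (x y z : M.obj (op c)) (hxy : Nbr J R x y) (hyz : Nbr J R y z) (hxz : Nbr J R x z),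
    ω.toFun x y hxy * ω.toFun y z hyz = ω.toFun x z hxz

/-- `f : U → G` is a partial primitive of `ω`: `f(y)⁻¹ * f(z) = ω(y, z)` for all `y ∼ z` in `U`. -/
def IsPrimitive (ω : OneForm J R M G) {c : C} {U : StageSub M c}
    (f : StageMap U (groupCarrier G)) : Prop :=
  ∀ ⦃d : C⦄ (g : d ⟶ c) (y z : M.obj (op d)) (hy : U.mem g y) (hz : U.mem g z)
    (h : Nbr J R y z),
    (f.toFun g y hy : G.obj (op d))⁻¹ * (f.toFun g z hz : G.obj (op d)) = ω.toFun y z h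

end SDG

/-! A primitive normalized at `x₀` must equal, at the end of any path from `x₀`, the ordered product
of `ω` over the steps of the path; this gives uniqueness. Existence amounts to path independence,
that is, the product along every loop is `1` (`PathVal.eq_one_of_loop`); the locally defined
products then glue because `G` is a sheaf.

Locally the base point of a loop lies in a chart, and formal étaleness keeps the whole loop there
(`Chart.exists_of_nbr`). In coordinates the loop is a list of steps in D(m) with sum 0. Scale all
steps by a scalar `t`. Since `G` lies in a KL algebra, the product becomes a polynomial P(t) with
P(0) = 1. For ε² = 0 one has P(t + ε) = P(t) · ω(r + ts, r + (t + ε)s), where r is the base point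
and s the sum of the steps (`CoordForm.path_add`). As s = 0, the derivative of P vanishes, so P is
constant because ℚ ⊆ R, and P(1) = 1.

The formula for P(t + ε) needs flatness on parallelograms with sides x, y ∈ D(m) even when x + y ∉
D(m) (`CoordForm.val_comm`), whereas closedness gives it only for x + y ∈ D(m). The defect is
bilinear and changes sign under exchange of x and y; vanishing for x + y ∈ D(m) kills its
antisymmetric part, hence all of it, as 2 is invertible. -/

namespace SDG

variable {C : Type u} [Category.{v} C]

/-! ### Restriction maps -/

section Restriction

variable {R : Cᵒᵖ ⥤ CommRingCat.{w}}

/-- Restriction of scalars along a map of stages. -/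
def res (R : Cᵒᵖ ⥤ CommRingCat.{w}) {c d : C} (f : d ⟶ c) : R.obj (op c) →+* R.obj (op d) :=
  (R.map f.op).hom

theorem res_comp {c d e : C} (f : d ⟶ c) (g : e ⟶ d) (r : R.obj (op c)) :
    res R (g ≫ f) r = res R g (res R f r) := by
  simp [res]

theorem res_id {c : C} (r : R.obj (op c)) : res R (𝟙 c) r = r := by
  simp [res]

/-- Vectors with coordinates in `R` at the stage `c`. -/
abbrev Vec (R : Cᵒᵖ ⥤ CommRingCat.{w}) (n : ℕ) (c : C) : Type w := Fin n → R.obj (op c)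

/-- Restriction of vectors along a map of stages. -/
def vres (R : Cᵒᵖ ⥤ CommRingCat.{w}) {n : ℕ} {c d : C} (f : d ⟶ c) : Vec R n c →+ Vec R n d where
  toFun x i := res R f (x i)
  map_zero' := by ext; simp
  map_add' _ _ := by ext; simp

theorem vres_apply {n : ℕ} {c d : C} (f : d ⟶ c) (x : Vec R n c) (i : Fin n) :
    vres R f x i = res R f (x i) := rfl

theorem vres_comp {n : ℕ} {c d e : C} (f : d ⟶ c) (g : e ⟶ d) (x : Vec R n c) :
    vres R (g ≫ f) x = vres R g (vres R f x) :=
  funext fun _ => res_comp f g _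

theorem vres_id {n : ℕ} {c : C} (x : Vec R n c) : vres R (𝟙 c) x = x :=
  funext fun _ => res_id _

/-- Membership in `D_k(n)`. -/
def InD (k : ℕ) {n : ℕ} {A : Type*} [CommRing A] (x : Fin n → A) : Prop :=
  ∀ s : Fin (k + 1) → Fin n, ∏ j, x (s j) = 0

theorem InD.vres {k n : ℕ} {c d : C} {x : Vec R n c} (hx : InD k x) (f : d ⟶ c) :
    InD k (vres R f x) := fun s => by
  have h := congrArg (res R f) (hx s)
  rwa [map_prod, map_zero] at h

end Restriction

/-! ### Closure properties of D_k(n). -/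

section Infinitesimals

variable {A : Type*} [CommRing A] {n : ℕ}

theorem InD.smul {k : ℕ} {x : Fin n → A} (hx : InD k x) (t : A) : InD k (t • x) := fun s => by
  simp [Finset.prod_mul_distrib, hx s]

theorem InD.zero (k : ℕ) : InD k (0 : Fin n → A) := fun s => by
  simp

theorem inD_one_iff {x : Fin n → A} : InD 1 x ↔ ∀ i j, x i * x j = 0 := by
  refine ⟨fun h i j => ?_, fun h s => ?_⟩
  · simpa [Fin.prod_univ_two] using h ![i, j]
  · simpa [Fin.prod_univ_two] using h (s 0) (s 1)

theorem InD.neg {x : Fin n → A} (hx : InD 1 x) : InD 1 (-x) := by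
  rw [inD_one_iff] at hx ⊢
  simpa using hx

theorem inD_one_smul_of_sq_eq_zero {t : A} (ht : t * t = 0) (x : Fin n → A) : InD 1 (t • x) := by
  rw [inD_one_iff]
  intro i j
  simp only [Pi.smul_apply, smul_eq_mul]
  linear_combination x i * x j * ht

theorem InD.prod_eq_zero {k : ℕ} {x : Fin n → A} (hx : InD k x) {ι : Type*} (s : ι → Fin n)
    (S : Finset ι) (hS : k + 1 ≤ S.card) : ∏ j ∈ S, x (s j) = 0 := by
  obtain ⟨T, hTS, hT⟩ := Finset.exists_subset_card_eq hS
  classical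
  rw [← Finset.prod_sdiff hTS]
  refine mul_eq_zero_of_right _ ?_
  have e := T.equivFinOfCardEq hT
  rw [← Finset.prod_coe_sort, ← hx fun j => s (e.symm j)]
  exact (Equiv.prod_comp e.symm fun j : T => x (s j)).symm

/-- Expand a product of k + l + 1 coordinates of x + y: each term has at least k + 1 factors from x
or at least l + 1 from y. -/
theorem InD.add {k l : ℕ} {x y : Fin n → A} (hx : InD k x) (hy : InD l y) :
    InD (k + l) (x + y) := fun s => by
  simp only [Pi.add_apply, Finset.prod_add]
  refine Finset.sum_eq_zero fun S _ => ?_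
  by_cases hS : k + 1 ≤ S.card
  · rw [hx.prod_eq_zero s S hS, zero_mul]
  · rw [hy.prod_eq_zero s _ ?_, mul_zero]
    have := Finset.card_sdiff_add_card_eq_card S.subset_univ
    rw [Finset.card_univ, Fintype.card_fin] at this
    omega

end Infinitesimals

/-! ### Algebras and the Kock-Lawvere axiom -/

namespace AlgebraObj

variable {R : Cᵒᵖ ⥤ CommRingCat.{w}} (W : AlgebraObj R)

/-- The ring of elements at the stage `c`. -/
abbrev At (c : C) : Type w := W.ring.obj (op c)

/-- Restriction along a map of stages. -/
def rs {c d : C} (f : d ⟶ c) : W.At c →+* W.At d := (W.ring.map f.op).hom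

/-- The structure homomorphism at the stage `c`. -/
def un (c : C) : R.obj (op c) →+* W.At c := (W.unit.app (op c)).hom

variable {W}

theorem rs_comp {c d e : C} (f : d ⟶ c) (g : e ⟶ d) (r : W.At c) :
    W.rs (g ≫ f) r = W.rs g (W.rs f r) := by
  simp [rs]

theorem rs_id {c : C} (r : W.At c) : W.rs (𝟙 c) r = r := by
  simp [rs]

theorem rs_un {c d : C} (f : d ⟶ c) (r : R.obj (op c)) :
    W.rs f (W.un c r) = W.un d (res R f r) :=
  (NatTrans.naturality_apply W.unit f.op r).symm

theorem un_comm {c : C} (r : R.obj (op c)) (a : W.At c) : Commute (W.un c r) a :=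
  W.central _ r a

/-- The monomial with exponent `α`. -/
def _root_.SDG.mono {k n : ℕ} {A : Type*} [CommRing A] (α : Exponent k n) (x : Fin n → A) : A :=
  ∏ i, x i ^ (α.1 i : ℕ)

theorem _root_.SDG.res_mono {k n : ℕ} {c d : C} (f : d ⟶ c) (α : Exponent k n) (x : Vec R n c) :
    res R f (mono α x) = mono α (vres R f x) := by
  simp [mono, vres_apply]

variable (W) in
/-- A family of maps `D_k(n) → W` over the stage `c` that is compatible with restriction. -/
def IsNatural (k : ℕ) {n : ℕ} {c : C} (F : ∀ ⦃d : C⦄, (d ⟶ c) → Vec R n d → W.At d) : Prop :=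
  ∀ ⦃d e : C⦄ (f : d ⟶ c) (g : e ⟶ d) (x : Vec R n d), InD k x →
    F (g ≫ f) (vres R g x) = W.rs g (F f x)

variable (W) in
/-- The family `F` is given on `D_k(n)` by the polynomial with coefficients `a`. -/
def IsExpansion {k n : ℕ} {c : C} (F : ∀ ⦃d : C⦄, (d ⟶ c) → Vec R n d → W.At d)
    (a : Exponent k n → W.At c) : Prop :=
  ∀ ⦃d : C⦄ (f : d ⟶ c) (x : Vec R n d), InD k x →
    F f x = ∑ α, W.un d (mono α x) * W.rs f (a α)

/-- Families are total, with arbitrary values outside D_k(n), so that no membership proofs enter the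
formulas. -/
theorem IsKL.existsUnique_expansion (hW : W.IsKL) {k n : ℕ} {c : C}
    {F : ∀ ⦃d : C⦄, (d ⟶ c) → Vec R n d → W.At d} (hF : W.IsNatural k F) :
    ∃! a : Exponent k n → W.At c, W.IsExpansion F a :=
  hW k n c ⟨fun _ f x _ => F f x, fun _ _ f g x hx => hF f g x hx⟩

theorem IsExpansion.restrict {k n : ℕ} {c d : C}
    {F : ∀ ⦃d : C⦄, (d ⟶ c) → Vec R n d → W.At d} {a : Exponent k n → W.At c}
    (h : W.IsExpansion F a) (f : d ⟶ c) :
    W.IsExpansion (fun _ g x => F (g ≫ f) x) fun α => W.rs f (a α) := fun e g x hx => by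
  simp only [h (g ≫ f) x hx, rs_comp]

/-- Expand in y for fixed x; by uniqueness the coefficients are natural in x, so they can be
expanded in turn. -/
theorem IsKL.exists_expansion₂ (hW : W.IsKL) {k l m n : ℕ} {c : C}
    (H : ∀ ⦃d : C⦄, (d ⟶ c) → Vec R m d → Vec R n d → W.At d)
    (hH : ∀ ⦃d e : C⦄ (f : d ⟶ c) (g : e ⟶ d) (x : Vec R m d) (y : Vec R n d),
      InD k x → InD l y → H (g ≫ f) (vres R g x) (vres R g y) = W.rs g (H f x y)) :
    ∃ a : Exponent k m → Exponent l n → W.At c,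
      ∀ ⦃d : C⦄ (f : d ⟶ c) (x : Vec R m d) (y : Vec R n d), InD k x → InD l y →
        H f x y = ∑ α, ∑ β, W.un d (mono α x * mono β y) * W.rs f (a α β) := by
  have key : ∀ (d : C) (f : d ⟶ c) (x : Vec R m d), InD k x →
      ∃! a : Exponent l n → W.At d, W.IsExpansion (fun e g y => H (g ≫ f) (vres R g x) y) a := by
    intro d f x hx
    refine hW.existsUnique_expansion fun e e' g h y hy => ?_
    rw [vres_comp, Category.assoc]
    exact hH _ _ _ _ (hx.vres g) hy
  -- Junk values of `A` outside D_k(m) are harmless, since naturality is tested only on D_k(m).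
  choose! A hA hA' using fun d f x hx => key d f x hx
  have nat : ∀ β, W.IsNatural k fun d f x => A d f x β := by
    intro β d e f g x hx
    have h := (hA d f x hx).restrict g
    refine (congrFun (hA' e (g ≫ f) (vres R g x) (hx.vres g) (fun β => W.rs g (A d f x β))
      fun e' g' y hy => ?_) β).symm
    rw [← h g' y hy]
    simp only [vres_comp, Category.assoc]
  choose B hB _ using fun β => hW.existsUnique_expansion (nat β)
  refine ⟨fun α β => B β α, fun d f x y hx hy => ?_⟩
  have h := hA d f x hx (𝟙 d) y hy
  simp only [vres_id, rs_id, Category.id_comp] at h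
  rw [h, Finset.sum_comm]
  refine Finset.sum_congr rfl fun β _ => ?_
  rw [show A d f x β = _ from hB β f x hx, Finset.mul_sum]
  refine Finset.sum_congr rfl fun α _ => ?_
  rw [← mul_assoc, ← map_mul, mul_comm (mono β y)]

end AlgebraObj

/-! ### Exponents of degree one -/

section LinearExponents

/-- The exponents of degree at most `1`. -/
def linearExponent (n : ℕ) : Option (Fin n) → Exponent 1 n
  | none => ⟨fun _ => 0, by simp⟩
  | some i => ⟨fun j => if j = i then 1 else 0, by simp [apply_ite Fin.val]⟩

theorem linearExponent_bijective (n : ℕ) : Function.Bijective (linearExponent n) := by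
  constructor
  · rintro (_ | i) (_ | j) h
    · rfl
    · simpa [linearExponent] using congrFun (congrArg Subtype.val h) j
    · simpa [linearExponent] using congrFun (congrArg Subtype.val h) i
    · have := congrFun (congrArg Subtype.val h) i
      simp only [linearExponent, if_true] at this
      by_cases hij : i = j
      · rw [hij]
      · simp [hij] at this
  · rintro ⟨α, hα⟩
    by_cases h0 : ∀ i, α i = 0
    · exact ⟨none, Subtype.ext (funext fun i => (h0 i).symm)⟩
    · push Not at h0
      obtain ⟨i, hi⟩ := h0
      have hi' : (α i : ℕ) = 1 := by
        have := Fin.val_ne_of_ne hi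
        rw [Fin.val_zero] at this
        omega
      refine ⟨some i, Subtype.ext (funext fun j => ?_)⟩
      by_cases hij : j = i
      · subst hij
        simp [linearExponent, Fin.ext_iff, hi']
      · have h1 : (α i : ℕ) + α j ≤ ∑ l, (α l : ℕ) := by
          rw [← Finset.sum_pair (f := fun l => (α l : ℕ)) (Ne.symm hij)]
          exact Finset.sum_le_sum_of_subset (Finset.subset_univ _)
        have h2 : (α j : ℕ) = 0 := by omega
        rw [Fin.ext_iff, h2]
        simp [linearExponent, hij]

theorem sum_exponent_one {n : ℕ} {B : Type*} [AddCommMonoid B] (φ : Exponent 1 n → B) :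
    ∑ α, φ α = φ (linearExponent n none) + ∑ i, φ (linearExponent n (some i)) := by
  rw [← Fintype.sum_option fun o => φ (linearExponent n o)]
  exact ((linearExponent_bijective n).sum_comp φ).symm

variable {A : Type*} [CommRing A] {n : ℕ}

theorem mono_linearExponent_none (x : Fin n → A) : mono (linearExponent n none) x = 1 := by
  simp [mono, linearExponent]

theorem mono_linearExponent_some (x : Fin n → A) (i : Fin n) :
    mono (linearExponent n (some i)) x = x i := by
  simp only [mono, linearExponent, apply_ite Fin.val]
  rw [Finset.prod_eq_single i] <;> simp +contextual

theorem mono_smul {k : ℕ} (α : Exponent k n) (t : A) (x : Fin n → A) :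
    mono α (t • x) = t ^ (∑ i, (α.1 i : ℕ)) * mono α x := by
  simp [mono, mul_pow, Finset.prod_mul_distrib, Finset.prod_pow_eq_pow_sum]

end LinearExponents

namespace AlgebraObj

variable {R : Cᵒᵖ ⥤ CommRingCat.{w}} {W : AlgebraObj R}

/-! ### Polynomial functions of one scalar -/

/-- The value of a polynomial over `W` at a scalar of a later stage. -/
noncomputable def pev {c d : C} (p : Polynomial (W.At c)) (f : d ⟶ c) (t : R.obj (op d)) :
    W.At d :=
  p.eval₂ (W.rs f) (W.un d t)

/-- Holds although `W` is noncommutative, because the scalar `t` is central. -/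
theorem pev_mul {c d : C} (p q : Polynomial (W.At c)) (f : d ⟶ c) (t : R.obj (op d)) :
    pev (p * q) f t = pev p f t * pev q f t :=
  Polynomial.eval₂_mul_noncomm _ _ fun _ => (un_comm _ _).symm

theorem rs_pev {c d e : C} (p : Polynomial (W.At c)) (f : d ⟶ c) (g : e ⟶ d)
    (t : R.obj (op d)) : W.rs g (pev p f t) = pev p (g ≫ f) (res R g t) := by
  rw [pev, Polynomial.hom_eval₂, rs_un, pev]
  congr 1
  ext a
  exact (rs_comp f g a).symm

/-- Taylor's formula: the remainder is a multiple of ε². -/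
theorem pev_add_of_sq_eq_zero {c d : C} (p : Polynomial (W.At c)) (f : d ⟶ c)
    (t ε : R.obj (op d)) (hε : ε * ε = 0) :
    pev p f (t + ε) = pev p f t + W.un d ε * pev p.derivative f t := by
  induction p using Polynomial.induction_on' with
  | add p q hp hq =>
    simp only [pev, Polynomial.derivative_add, Polynomial.eval₂_add] at hp hq ⊢
    rw [hp, hq, mul_add]
    abel
  | monomial n a =>
    have key : (t + ε) ^ n = t ^ n + ε * (n * t ^ (n - 1)) := by
      obtain ⟨z, hz⟩ := Polynomial.powAddExpansion t ε n
      rw [hz]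
      linear_combination z * hε
    rw [Polynomial.derivative_monomial, pev, pev, pev, Polynomial.eval₂_monomial,
      Polynomial.eval₂_monomial, Polynomial.eval₂_monomial, ← map_pow, key, map_add, mul_add,
      map_mul, map_mul, map_mul, map_natCast, map_natCast, map_pow, map_pow,
      ← mul_assoc,
      ← (un_comm ε _).eq, mul_assoc, mul_assoc]

/-- A polynomial of degree at most `N` that vanishes on `D_N(1)` is zero. -/
theorem IsKL.polynomial_eq_zero (hW : W.IsKL) {c : C} {N : ℕ} (p : Polynomial (W.At c))
    (hN : p.natDegree ≤ N)
    (h : ∀ ⦃d : C⦄ (f : d ⟶ c) (t : R.obj (op d)), t ^ (N + 1) = 0 → pev p f t = 0) : p = 0 := by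
  -- On D_N(1) the zero map is expanded both by zero and by the coefficients of `p`; uniqueness
  -- identifies them.
  have h1 : W.IsExpansion (k := N) (n := 1) (c := c) (fun _ _ _ => 0) fun _ => 0 := by
    intro d f x hx
    simp
  have h2 : W.IsExpansion (k := N) (n := 1) (c := c) (fun _ _ _ => 0)
      fun α => p.coeff (α.1 0) := by
    intro d f x hx
    have hx0 : x 0 ^ (N + 1) = 0 := by simpa using hx fun _ => 0
    change (0 : W.At d) = _
    rw [← h f (x 0) hx0, pev, Polynomial.eval₂_eq_sum_range' _ (Nat.lt_succ_of_le hN),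
      Finset.sum_range]
    refine Fintype.sum_bijective
      (fun i : Fin (N + 1) => (⟨fun _ => i, by simpa using Nat.lt_succ_iff.1 i.2⟩ : Exponent N 1))
      ⟨fun i j hij => congrFun (congrArg Subtype.val hij) 0, fun α => ⟨α.1 0, Subtype.ext ?_⟩⟩
      _ _ fun i => ?_
    · funext i
      rw [Subsingleton.elim i 0]
    · simp only [mono, Finset.univ_unique, Finset.prod_singleton, map_pow, Fin.default_eq_zero]
      exact ((un_comm (x 0) _).pow_left _).eq.symm
  have h3 := (hW.existsUnique_expansion (k := N) (n := 1) (c := c) (F := fun _ _ _ => 0)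
    fun _ _ _ _ _ _ => (map_zero _).symm).unique h2 h1
  ext i
  by_cases hi : i ≤ N
  · exact congrFun h3 ⟨fun _ => ⟨i, Nat.lt_succ_of_le hi⟩, by simpa using hi⟩
  · exact Polynomial.coeff_eq_zero_of_natDegree_lt (by omega)

/-- Scalars of square zero can be cancelled when they are universally quantified. -/
theorem IsKL.cancel (hW : W.IsKL) {c : C} (a : W.At c)
    (h : ∀ ⦃d : C⦄ (f : d ⟶ c) (t : R.obj (op d)), t * t = 0 → W.un d t * W.rs f a = 0) :
    a = 0 := by
  have := hW.polynomial_eq_zero (N := 1) (Polynomial.monomial 1 a)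
    (Polynomial.natDegree_monomial_le a) fun d f t ht => by
      rw [pev, Polynomial.eval₂_monomial, pow_one, ← (un_comm t _).eq]
      exact h f t (by rw [← ht]; ring)
  simpa using this

theorem eq_zero_of_natCast_mul {c : C} (hRQ : Nonempty (Algebra ℚ (R.obj (op c)))) {n : ℕ}
    (hn : n ≠ 0) {a : W.At c} (h : (n : W.At c) * a = 0) : a = 0 := by
  obtain ⟨_⟩ := hRQ
  have h1 : W.un c (algebraMap ℚ _ (n : ℚ)⁻¹) * (n : W.At c) = 1 := by
    rw [← map_natCast (W.un c), ← map_mul, ← map_natCast (algebraMap ℚ (R.obj (op c))), ← map_mul,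
      inv_mul_cancel₀ (Nat.cast_ne_zero.2 hn), map_one, map_one]
  rw [← one_mul a, ← h1, mul_assoc, h, mul_zero]

/-- A polynomial function with vanishing derivative is constant. -/
theorem IsKL.pev_eq_of_forall_add (hW : W.IsKL)
    (hRQ : ∀ c : Cᵒᵖ, Nonempty (Algebra ℚ (R.obj c))) {c : C} (p : Polynomial (W.At c))
    (h : ∀ ⦃d : C⦄ (f : d ⟶ c) (t ε : R.obj (op d)), ε * ε = 0 → pev p f (t + ε) = pev p f t)
    {d : C} (f : d ⟶ c) (s t : R.obj (op d)) : pev p f s = pev p f t := by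
  have h1 : p.derivative = 0 := by
    -- The hypothesis says ε · p'(t) = 0 for every ε of square zero at every later stage, so ε
    -- cancels.
    refine hW.polynomial_eq_zero _ le_rfl fun d f t _ => hW.cancel _ fun e g ε hε => ?_
    have := h (g ≫ f) (res R g t) ε hε
    rwa [pev_add_of_sq_eq_zero _ _ _ _ hε, add_eq_left, ← rs_pev] at this
  have h2 : p = Polynomial.C (p.coeff 0) := by
    ext i
    rcases i with _ | i
    · simp
    · rw [Polynomial.coeff_C_succ]
      refine eq_zero_of_natCast_mul (hRQ _) i.succ_ne_zero ?_
      have := congrArg (fun q => q.coeff i) h1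
      simp only [Polynomial.coeff_derivative, Polynomial.coeff_zero] at this
      rw [← this, Nat.cast_comm, Nat.cast_succ]
  rw [h2, pev, pev, Polynomial.eval₂_C, Polynomial.eval₂_C]

/-! ### Bilinear expansions -/

/-- Vanishing on both axes removes the constant term and the terms linear in a single variable. -/
theorem IsKL.exists_bilinear (hW : W.IsKL) {m n : ℕ} {c : C}
    (H : ∀ ⦃d : C⦄, (d ⟶ c) → Vec R m d → Vec R n d → W.At d)
    (hH : ∀ ⦃d e : C⦄ (f : d ⟶ c) (g : e ⟶ d) (x : Vec R m d) (y : Vec R n d),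
      InD 1 x → InD 1 y → H (g ≫ f) (vres R g x) (vres R g y) = W.rs g (H f x y))
    (hl : ∀ ⦃d : C⦄ (f : d ⟶ c) (y : Vec R n d), InD 1 y → H f 0 y = 0)
    (hr : ∀ ⦃d : C⦄ (f : d ⟶ c) (x : Vec R m d), InD 1 x → H f x 0 = 0) :
    ∃ b : Fin m → Fin n → W.At c,
      ∀ ⦃d : C⦄ (f : d ⟶ c) (x : Vec R m d) (y : Vec R n d), InD 1 x → InD 1 y →
        H f x y = ∑ i, ∑ j, W.un d (x i * y j) * W.rs f (b i j) := by
  obtain ⟨a, ha⟩ := hW.exists_expansion₂ H hH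
  refine ⟨fun i j => a (linearExponent m (some i)) (linearExponent n (some j)),
    fun d f x y hx hy => ?_⟩
  have h0 := ha f 0 0 (InD.zero 1) (InD.zero 1)
  have h1 := ha f 0 y (InD.zero 1) hy
  have h2 := ha f x 0 hx (InD.zero 1)
  have h3 := ha f x y hx hy
  rw [hl f _ (InD.zero 1)] at h0
  rw [hl f y hy] at h1
  rw [hr f x hx] at h2
  simp only [sum_exponent_one, mono_linearExponent_none, mono_linearExponent_some, one_mul,
    mul_one, map_one, map_zero, zero_mul, mul_zero, Pi.zero_apply, Finset.sum_const_zero,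
    add_zero, Finset.sum_add_distrib] at h0 h1 h2 h3
  rw [h3]
  rw [← h0, zero_add] at h1 h2 ⊢
  rw [← h1, ← h2, zero_add, zero_add]

end AlgebraObj

/-! ### Closed forms in coordinates -/

open AlgebraObj

/-- A closed `1`-form on an open subobject `dom` of `R ^ m` with values in an algebra: `val r x`
is the value of the form at the pair `(r, r + x)`. -/
structure CoordForm {R : Cᵒᵖ ⥤ CommRingCat.{w}} (W : AlgebraObj R) (m : ℕ) where
  dom : ∀ ⦃d : C⦄, Vec R m d → Prop
  val : ∀ ⦃d : C⦄, Vec R m d → Vec R m d → W.At d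
  dom_res : ∀ ⦃c d : C⦄ (f : d ⟶ c) (r : Vec R m c), dom r → dom (vres R f r)
  dom_add : ∀ ⦃d : C⦄ (r x : Vec R m d) (k : ℕ), dom r → InD k x → dom (r + x)
  val_res : ∀ ⦃c d : C⦄ (f : d ⟶ c) (r x : Vec R m c), dom r → InD 1 x →
    val (vres R f r) (vres R f x) = W.rs f (val r x)
  val_zero : ∀ ⦃d : C⦄ (r : Vec R m d), dom r → val r 0 = 1
  val_mul : ∀ ⦃d : C⦄ (r x y : Vec R m d), dom r → InD 1 x → InD 1 y → InD 1 (x + y) →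
    val r x * val (r + x) y = val r (x + y)

namespace CoordForm

variable {R : Cᵒᵖ ⥤ CommRingCat.{w}} {W : AlgebraObj R} {m : ℕ} (Ω : CoordForm W m)

/-- A closed form is flat on all infinitesimal parallelograms. -/
theorem val_comm (hW : W.IsKL) (hRQ : ∀ c : Cᵒᵖ, Nonempty (Algebra ℚ (R.obj c))) {c : C}
    (r x y : Vec R m c) (hr : Ω.dom r) (hx : InD 1 x) (hy : InD 1 y) :
    Ω.val r x * Ω.val (r + x) y = Ω.val r y * Ω.val (r + y) x := by
  -- The commutation defect is trivial when either side is 0, hence bilinear.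
  obtain ⟨b, hb⟩ := hW.exists_bilinear (c := c)
    (fun d f x y => Ω.val (vres R f r) x * Ω.val (vres R f r + x) y -
      Ω.val (vres R f r) y * Ω.val (vres R f r + y) x)
    (fun d e f g x y hx hy => by
      have h0 := Ω.dom_res f r hr
      simp only [vres_comp, ← map_add, Ω.val_res g _ _ h0 hx, Ω.val_res g _ _ h0 hy,
        Ω.val_res g _ _ (Ω.dom_add _ _ _ h0 hx) hy, Ω.val_res g _ _ (Ω.dom_add _ _ _ h0 hy) hx,
        map_sub, map_mul])
    (fun d f y hy => by
      have h0 := Ω.dom_res f r hr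
      simp [Ω.val_zero _ h0, Ω.val_zero _ (Ω.dom_add _ _ _ h0 hy)])
    (fun d f y hy => by
      have h0 := Ω.dom_res f r hr
      simp [Ω.val_zero _ h0, Ω.val_zero _ (Ω.dom_add _ _ _ h0 hy)])
  have h1 := hb (𝟙 c) x y hx hy
  have h2 := hb (𝟙 c) y x hy hx
  simp only [vres_id, rs_id] at h1 h2
  set K := Ω.val r x * Ω.val (r + x) y - Ω.val r y * Ω.val (r + y) x with hK
  -- Exchanging x and y changes the sign of the defect, so its double is the antisymmetrization of
  -- `b`.
  have h3 : K + K = ∑ i, ∑ j, W.un c (x i * y j - y i * x j) * b i j := by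
    have h2' : -K = ∑ i, ∑ j, W.un c (y i * x j) * b i j := by rw [← h2, hK, neg_sub]
    rw [← sub_neg_eq_add K K, h2', h1, ← Finset.sum_sub_distrib]
    refine Finset.sum_congr rfl fun i _ => ?_
    rw [← Finset.sum_sub_distrib]
    refine Finset.sum_congr rfl fun j _ => ?_
    rw [map_sub, sub_mul]
  have h4 : K + K = 0 := by
    -- It suffices to kill K + K after multiplication by four generic scalars of square zero, moved
    -- to a common stage below.
    refine hW.cancel _ fun d₁ f₁ t₁ ht₁ => hW.cancel _ fun d₂ f₂ t₂ ht₂ =>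
      hW.cancel _ fun d₃ f₃ t₃ ht₃ => hW.cancel _ fun d₄ f₄ t₄ ht₄ => ?_
    set s₁ := res R f₄ (res R f₃ (res R f₂ t₁)) with hs₁
    set s₂ := res R f₄ (res R f₃ t₂) with hs₂
    set s₃ := res R f₄ t₃ with hs₃
    have q₁ : s₁ * s₁ = 0 := by rw [hs₁, ← map_mul, ← map_mul, ← map_mul, ht₁]; simp
    have q₂ : s₂ * s₂ = 0 := by rw [hs₂, ← map_mul, ← map_mul, ht₂]; simp
    have q₃ : s₃ * s₃ = 0 := by rw [hs₃, ← map_mul, ht₃, map_zero]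
    set g := f₄ ≫ f₃ ≫ f₂ ≫ f₁ with hg
    have e : W.un d₄ t₄ * W.rs f₄ (W.un d₃ t₃ * W.rs f₃ (W.un d₂ t₂ * W.rs f₂ (W.un d₁ t₁ *
        W.rs f₁ (K + K)))) = W.un d₄ (s₁ * s₂ * s₃ * t₄) * W.rs g (K + K) := by
      rw [hg, rs_comp, rs_comp, rs_comp]
      simp only [map_mul (W.rs _), rs_un, ← mul_assoc, ← map_mul (W.un _)]
      congr 2
      simp only [hs₁, hs₂, hs₃, map_mul]
      ring
    rw [e]
    set x' := vres R g x with hx'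
    set y' := vres R g y with hy'
    -- Take u = s₁(s₂x + s₃y) and v = t₄(s₃y − s₂x). The factors s₁ and t₄ put u and v in D(m). As
    -- s₂² = s₃² = 0, u_i v_j = s₁s₂s₃t₄(x_i y_j − y_i x_j), which is antisymmetric in i, j; so the
    -- cross terms cancel and u + v ∈ D(m).
    have hu : InD 1 ((s₁ * s₂) • x' + (s₁ * s₃) • y') := by
      rw [inD_one_iff]
      intro i j
      simp only [Pi.add_apply, Pi.smul_apply, smul_eq_mul]
      linear_combination (s₂ * x' i + s₃ * y' i) * (s₂ * x' j + s₃ * y' j) * q₁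
    have hv : InD 1 ((s₃ * t₄) • y' - (s₂ * t₄) • x') := by
      rw [inD_one_iff]
      intro i j
      simp only [Pi.sub_apply, Pi.smul_apply, smul_eq_mul]
      linear_combination (s₃ * y' i - s₂ * x' i) * (s₃ * y' j - s₂ * x' j) * ht₄
    have huv : InD 1 ((s₁ * s₂) • x' + (s₁ * s₃) • y' + ((s₃ * t₄) • y' - (s₂ * t₄) • x')) := by
      rw [inD_one_iff]
      intro i j
      simp only [Pi.add_apply, Pi.sub_apply, Pi.smul_apply, smul_eq_mul]
      linear_combination (s₂ * x' i + s₃ * y' i) * (s₂ * x' j + s₃ * y' j) * q₁ +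
        (s₃ * y' i - s₂ * x' i) * (s₃ * y' j - s₂ * x' j) * ht₄ -
        2 * s₁ * t₄ * x' i * x' j * q₂ + 2 * s₁ * t₄ * y' i * y' j * q₃
    have h5 := hb g _ _ hu hv
    have hr' := Ω.dom_res g r hr
    -- Both composites are the value at u + v, so `b` vanishes at (u, v); this value is the chosen
    -- multiple of K + K.
    rw [Ω.val_mul _ _ _ hr' hu hv huv, Ω.val_mul _ _ _ hr' hv hu (by rwa [add_comm]),
      add_comm ((s₃ * t₄) • y' - (s₂ * t₄) • x'), sub_self] at h5
    rw [h5, h3, map_sum, Finset.mul_sum]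
    refine Finset.sum_congr rfl fun i _ => ?_
    rw [map_sum, Finset.mul_sum]
    refine Finset.sum_congr rfl fun j _ => ?_
    rw [map_mul (W.rs g), rs_un, ← mul_assoc, ← map_mul (W.un d₄)]
    congr 2
    simp only [map_sub, map_mul, ← vres_apply, ← hx', ← hy', Pi.add_apply, Pi.sub_apply,
      Pi.smul_apply, smul_eq_mul]
    linear_combination s₁ * t₄ * x' i * x' j * q₂ - s₁ * t₄ * y' i * y' j * q₃
  have h6 : K = 0 := eq_zero_of_natCast_mul (hRQ _) two_ne_zero (by rw [Nat.cast_two, two_mul, h4])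
  exact sub_eq_zero.1 h6

/-- The value of the form along the path through `r` with steps `t • x` for `x` in the list `l`,
the last step being the head of the list. -/
def path {d : C} (r : Vec R m d) (t : R.obj (op d)) : List (Vec R m d) → W.At d
  | [] => 1
  | x :: l => path r t l * Ω.val (r + t • l.sum) (t • x)

/-- Hence every vertex of a path stays in the domain, through `dom_add`. -/
theorem _root_.SDG.inD_sum {A : Type*} [CommRing A] {n : ℕ} {l : List (Fin n → A)}
    (hl : ∀ x ∈ l, InD 1 x) : InD l.length l.sum := by
  induction l with
  | nil => exact InD.zero 0
  | cons x l ih =>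
    rw [List.sum_cons, List.length_cons, add_comm x]
    exact (ih fun y hy => hl y (List.mem_cons_of_mem _ hy)).add (hl x List.mem_cons_self)

/-- The differential equation of the scaled path. Inductively, the displacement ε • s of the end of
the shorter path is carried across the new step t • x by `val_comm`. -/
theorem path_add (hW : W.IsKL) (hRQ : ∀ c : Cᵒᵖ, Nonempty (Algebra ℚ (R.obj c))) {d : C}
    {r : Vec R m d} (hr : Ω.dom r) {l : List (Vec R m d)} (hl : ∀ x ∈ l, InD 1 x)
    (t ε : R.obj (op d)) (hε : ε * ε = 0) :
    Ω.path r (t + ε) l = Ω.path r t l * Ω.val (r + t • l.sum) (ε • l.sum) := by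
  induction l with
  | nil => simp [path, Ω.val_zero r hr]
  | cons x l ih =>
    have hl' : ∀ y ∈ l, InD 1 y := fun y hy => hl y (List.mem_cons_of_mem _ hy)
    have hx : InD 1 x := hl x List.mem_cons_self
    have hs := inD_sum hl'
    rw [path, path, ih hl', List.sum_cons]
    set s := l.sum
    have hX : Ω.dom (r + t • s) := Ω.dom_add _ _ _ hr (hs.smul t)
    have e₁ : r + (t + ε) • s = r + t • s + ε • s := by rw [add_smul, add_assoc]
    have e₂ : r + t • (x + s) = r + t • s + t • x := by rw [smul_add, add_comm (t • x), add_assoc]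
    rw [e₁, e₂]
    set X := r + t • s
    have hεs : InD 1 (ε • s) := inD_one_smul_of_sq_eq_zero hε s
    have hXs : Ω.dom (X + ε • s) := Ω.dom_add _ _ _ hX hεs
    have hXx : Ω.dom (X + t • x) := Ω.dom_add _ _ _ hX (hx.smul t)
    have hεx : InD 1 (ε • x) := hx.smul ε
    -- Split (t + ε)x into tx, εx and ε(x + s) into εs, εx. The trailing factors for εx agree, and
    -- the parallelogram with sides εs, tx remains.
    rw [add_smul t ε x, ← Ω.val_mul _ _ _ hXs (hx.smul t) hεx
      (by rw [← add_smul]; exact hx.smul _), smul_add, add_comm (ε • x),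
      ← Ω.val_mul _ _ _ hXx hεs hεx
        (by rw [← smul_add]; exact inD_one_smul_of_sq_eq_zero hε _),
      add_right_comm X (ε • s)]
    have h := Ω.val_comm hW hRQ X (ε • s) (t • x) hX hεs (hx.smul t)
    simp only [mul_assoc]
    rw [← mul_assoc (Ω.val X (ε • s)), h, mul_assoc]

/-- Each factor has an expansion in the partial sum and the step; scaling both by `t` turns a
monomial into a power of `t` whose exponent is the total degree. -/
theorem exists_polynomial_path (hW : W.IsKL) {c : C} {r : Vec R m c} (hr : Ω.dom r)
    {l : List (Vec R m c)} (hl : ∀ x ∈ l, InD 1 x) :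
    ∃ p : Polynomial (W.At c), ∀ ⦃d : C⦄ (f : d ⟶ c) (t : R.obj (op d)),
      Ω.path (vres R f r) t (l.map (vres R f)) = pev p f t := by
  induction l with
  | nil => exact ⟨1, fun d f t => by simp [path, pev]⟩
  | cons x l ih =>
    have hl' : ∀ y ∈ l, InD 1 y := fun y hy => hl y (List.mem_cons_of_mem _ hy)
    have hx : InD 1 x := hl x List.mem_cons_self
    have hs := inD_sum hl'
    obtain ⟨p, hp⟩ := ih hl'
    obtain ⟨a, ha⟩ := hW.exists_expansion₂ (k := l.length) (l := 1) (c := c)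
      (fun d f s x => Ω.val (vres R f r + s) x) fun d e f g s x hs hx => by
        have h0 := Ω.dom_add _ _ _ (Ω.dom_res f r hr) hs
        simp only [vres_comp, ← map_add, Ω.val_res g _ _ h0 hx]
    refine ⟨p * ∑ α, ∑ β, Polynomial.monomial ((∑ i, (α.1 i : ℕ)) + ∑ i, (β.1 i : ℕ))
      (W.un c (mono α l.sum * mono β x) * a α β), fun d f t => ?_⟩
    rw [pev_mul, List.map_cons, path, hp, ← map_list_sum]
    congr 1
    refine (ha f _ _ ((hs.vres f).smul t) ((hx.vres f).smul t)).trans ?_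
    simp only [pev, Polynomial.eval₂_finsetSum, Polynomial.eval₂_monomial]
    refine Finset.sum_congr rfl fun α _ => Finset.sum_congr rfl fun β _ => ?_
    rw [mono_smul, mono_smul, map_mul (W.rs f), rs_un, map_mul (res R f), res_mono, res_mono,
      ← ((un_comm t _).pow_left _).eq, ← map_pow, ← mul_assoc (W.un d _), ← map_mul (W.un d)]
    congr 2
    ring

/-- The loop is contracted by scaling: by `path_add` the polynomial in the scale has zero
derivative, so its values at 1 and 0 agree. -/
theorem path_eq_one_of_sum_eq_zero (hW : W.IsKL)
    (hRQ : ∀ c : Cᵒᵖ, Nonempty (Algebra ℚ (R.obj c))) {c : C} {r : Vec R m c} (hr : Ω.dom r)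
    {l : List (Vec R m c)} (hl : ∀ x ∈ l, InD 1 x) (hsum : l.sum = 0) : Ω.path r 1 l = 1 := by
  obtain ⟨p, hp⟩ := Ω.exists_polynomial_path hW hr hl
  have hc := hW.pev_eq_of_forall_add hRQ p (fun d f t ε hε => by
    have hl' : ∀ x ∈ l.map (vres R f), InD 1 x := by
      intro x hx
      obtain ⟨y, hy, rfl⟩ := List.mem_map.1 hx
      exact (hl y hy).vres f
    have hr' := Ω.dom_res f r hr
    rw [← hp, ← hp, Ω.path_add hW hRQ hr' hl' t ε hε, ← map_list_sum, hsum]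
    simp [Ω.val_zero _ hr']) (𝟙 c) 1 0
  have h0 : ∀ l' : List (Vec R m c), Ω.path r 0 l' = 1 := by
    intro l'
    induction l' with
    | nil => rfl
    | cons x l' ih => simp [path, ih, Ω.val_zero r hr]
  rw [← hp, ← hp] at hc
  simp only [vres_id, funext vres_id, List.map_id'] at hc
  rw [hc, h0]

end CoordForm

/-! ### Sheaves -/

theorem map_map_apply (P : Cᵒᵖ ⥤ Type w) {c d e : C} (f : d ⟶ c) (g : e ⟶ d)
    (x : P.obj (op c)) : P.map g.op (P.map f.op x) = P.map (g ≫ f).op x := by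
  simp

theorem map_id_apply (P : Cᵒᵖ ⥤ Type w) {c : C} (x : P.obj (op c)) :
    P.map (𝟙 c).op x = x := by
  simp

theorem eq_of_locally_eq {J : GrothendieckTopology C} {P : Cᵒᵖ ⥤ Type w}
    (hP : Presieve.IsSheaf J P) {c : C} {S : Sieve c} (hS : S ∈ J c) {s t : P.obj (op c)}
    (h : ∀ ⦃d : C⦄ (f : d ⟶ c), S f → P.map f.op s = P.map f.op t) : s = t :=
  (hP S hS).isSeparatedFor.ext fun _ f hf => h f hf

/-- A subobject that is a sheaf contains every element that it contains locally. -/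
theorem exists_app_eq_of_locally {J : GrothendieckTopology C} {P Q : Cᵒᵖ ⥤ Type w}
    (hP : Presieve.IsSheaf J P) (hQ : Presieve.IsSheaf J Q) (p : P ⟶ Q)
    (hp : ∀ c, Function.Injective (p.app c)) {c : C} {S : Sieve c} (hS : S ∈ J c)
    (y : Q.obj (op c))
    (h : ∀ ⦃d : C⦄ (f : d ⟶ c), S f → ∃ x : P.obj (op d), p.app _ x = Q.map f.op y) :
    ∃ x : P.obj (op c), p.app _ x = y := by
  choose x hx using h
  obtain ⟨t, ht, -⟩ := hP S hS (fun d f hf => x f hf) (by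
    intro d₁ d₂ e g₁ g₂ f₁ f₂ h₁ h₂ h12
    apply hp
    rw [NatTrans.naturality_apply, NatTrans.naturality_apply, hx, hx, map_map_apply,
      map_map_apply, h12])
  refine ⟨t, eq_of_locally_eq hQ hS fun d f hf => ?_⟩
  rw [← NatTrans.naturality_apply, ht f hf, hx]

/-! ### Charts -/

section Charts

variable {J : GrothendieckTopology C} {R : Cᵒᵖ ⥤ CommRingCat.{w}} {M : Cᵒᵖ ⥤ Type w}

theorem IsFormallyEtale.exists_lift {X Y : Cᵒᵖ ⥤ Type w} {p : X ⟶ Y} (hp : IsFormallyEtale R p)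
    {k n : ℕ} {c : C} (F : StageMap (infinitesimalAt R k n c) Y) (x : X.obj (op c))
    (h0 : F.toFun (𝟙 c) (pow.origin R n (op c)) (origin_mem_infinitesimal R k n (op c)) =
      p.app _ x) :
    ∃ F' : StageMap (infinitesimalAt R k n c) X,
      (∀ ⦃d : C⦄ (f : d ⟶ c) (y : (pow R n).obj (op d)) (hy : (infinitesimalAt R k n c).mem f y),
        p.app _ (F'.toFun f y hy) = F.toFun f y hy) ∧
      F'.toFun (𝟙 c) (pow.origin R n (op c)) (origin_mem_infinitesimal R k n (op c)) = x := by
  obtain ⟨F', ⟨rfl, h⟩, -⟩ := hp k n c F x h0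
  exact ⟨F', fun _ _ _ _ => rfl, h⟩

/-- The increments of a map `D_1(n) → R ^ m` belong to `D_1(m)`. -/
theorem inD_sub_of_isNatural (hRKL : (AlgebraObj.self R).IsKL) {m n : ℕ} {c : C}
    (F : ∀ ⦃d : C⦄, (d ⟶ c) → Vec R n d → Vec R m d)
    (hF : ∀ ⦃d e : C⦄ (f : d ⟶ c) (g : e ⟶ d) (x : Vec R n d), InD 1 x →
      F (g ≫ f) (vres R g x) = vres R g (F f x))
    (x : Vec R n c) (hx : InD 1 x) : InD 1 (F (𝟙 c) x - F (𝟙 c) 0) := by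
  -- By the KL axiom each increment is linear in x, so products of two increments only involve the
  -- vanishing x_l x_l'.
  have key : ∀ i, ∃ b : Fin n → R.obj (op c), F (𝟙 c) x i - F (𝟙 c) 0 i = ∑ l, x l * b l := by
    intro i
    obtain ⟨a, ha, -⟩ := hRKL.existsUnique_expansion (k := 1) (n := n) (c := c)
      (F := fun d f x => (F f x i : R.obj (op d)))
      fun d e f g x hx => congrFun (hF f g x hx) i
    refine ⟨fun l => (AlgebraObj.self R).rs (𝟙 c) (a (linearExponent n (some l))), ?_⟩
    have h1 := ha (𝟙 c) x hx
    have h2 := ha (𝟙 c) 0 (InD.zero 1)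
    rw [sum_exponent_one] at h1 h2
    simp only [mono_linearExponent_none, mono_linearExponent_some, Pi.zero_apply, map_zero,
      zero_mul, Finset.sum_const_zero, add_zero] at h1 h2
    refine (congrArg₂ (fun s t : R.obj (op c) => s - t) h1 h2).trans ?_
    exact add_sub_cancel_left (G := R.obj (op c)) _ _
  choose b hb using key
  rw [inD_one_iff] at hx ⊢
  intro i j
  simp only [Pi.sub_apply]
  rw [hb, hb, Finset.sum_mul_sum]
  refine Finset.sum_eq_zero fun l _ => Finset.sum_eq_zero fun l' _ => ?_
  linear_combination b i l * b j l' * hx l l'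

namespace Chart

variable (U : Chart J R M)

/-- The coordinate vector of a point of the chart. -/
def crd {c : C} (a : U.domain.obj (op c)) : Vec R U.dim c := U.coord.app (op c) a

theorem crd_injective {c : C} : Function.Injective (U.crd (c := c)) := U.coord_injective (op c)

theorem crd_map {c d : C} (f : d ⟶ c) (a : U.domain.obj (op c)) :
    U.crd (U.domain.map f.op a) = vres R f (U.crd a) :=
  NatTrans.naturality_apply U.coord f.op a

theorem incl_map {c d : C} (f : d ⟶ c) (a : U.domain.obj (op c)) :
    U.incl.app _ (U.domain.map f.op a) = M.map f.op (U.incl.app _ a) :=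
  NatTrans.naturality_apply U.incl f.op a

/-- The translation `D_k(dim) → R ^ dim` based at the coordinates of a point. -/
def translation {n : ℕ} {c : C} (r : Vec R n c) (k : ℕ) :
    StageMap (infinitesimalAt R k n c) (pow R n) where
  toFun d f x _ := vres R f r + (show Vec R n d from x)
  naturality d e f g x _ := by
    change vres R (g ≫ f) r + vres R g (show Vec R n d from x) =
      vres R g (vres R f r + show Vec R n d from x)
    rw [vres_comp, map_add]

/-- Étaleness of the coordinate map: the D_k-disc around the coordinates of a point lies in the
chart. -/
theorem translation_lift {c : C} (a : U.domain.obj (op c)) (k : ℕ) :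
    ∃ F : StageMap (infinitesimalAt R k U.dim c) U.domain,
      (∀ ⦃d : C⦄ (f : d ⟶ c) (x : Vec R U.dim d) (hx : InD k x),
        U.crd (F.toFun f x hx) = vres R f (U.crd a) + x) ∧
      F.toFun (𝟙 c) (pow.origin R _ (op c)) (origin_mem_infinitesimal R k _ (op c)) = a :=
  U.coord_etale.exists_lift (translation (U.crd a) k) a (by
    change vres R (𝟙 c) (U.crd a) + 0 = U.crd a
    rw [vres_id, add_zero])

theorem exists_crd_eq_add {c : C} (a : U.domain.obj (op c)) {k : ℕ} {x : Vec R U.dim c}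
    (hx : InD k x) : ∃ b, U.crd b = U.crd a + x := by
  obtain ⟨F, hF, -⟩ := U.translation_lift a k
  exact ⟨F.toFun (𝟙 c) x hx, by rw [hF, vres_id]⟩

/-- The neighbour relation may be tested in any chart. -/
theorem exists_of_chart (hRKL : (AlgebraObj.self R).IsKL) (U U' : Chart J R M) {c : C}
    {a : U.domain.obj (op c)} {a' b' : U'.domain.obj (op c)}
    (ha : U'.incl.app _ a' = U.incl.app _ a) (hab : InD 1 (U'.crd b' - U'.crd a')) :
    ∃ b, U.incl.app _ b = U'.incl.app _ b' ∧ InD 1 (U.crd b - U.crd a) := by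
  -- The D(n)-disc of `U'` around `a'` lifts to `U` because the inclusion of `U` is étale; the lift
  -- at the difference vector is the required point.
  obtain ⟨F, hF, hF0⟩ := U'.translation_lift a' 1
  obtain ⟨K, hK, hK0⟩ := U.incl_etale.exists_lift (F.comp U'.incl) a (by
    rw [← ha, ← hF0]; rfl)
  have hb' : F.toFun (𝟙 c) (U'.crd b' - U'.crd a') hab = b' := by
    apply U'.crd_injective
    rw [hF, vres_id, add_sub_cancel]
  refine ⟨K.toFun (𝟙 c) (U'.crd b' - U'.crd a') hab, ?_, ?_⟩
  · exact (hK _ _ _).trans (congrArg (U'.incl.app _) hb')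
  · classical
    have h := inD_sub_of_isNatural hRKL
      (fun d f x => if hx : InD 1 x then U.crd (K.toFun f x hx) else 0)
      (fun d e f g x hx => by
        rw [dif_pos hx, dif_pos (hx.vres g)]
        exact (congrArg U.crd (K.naturality f g x hx)).trans (U.crd_map g _)) _ hab
    rw [dif_pos hab, dif_pos (InD.zero 1)] at h
    rw [← hK0]
    exact h

theorem nbr_of_inD (U : Chart J R M) {c : C} {a b : U.domain.obj (op c)}
    (h : InD 1 (U.crd b - U.crd a)) : Nbr J R (U.incl.app _ a) (U.incl.app _ b) :=
  ⟨⊤, J.top_mem c, fun d f _ => ⟨U, U.domain.map f.op a, U.domain.map f.op b, U.incl_map f a,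
    U.incl_map f b, by
      have := h.vres f
      rwa [map_sub, ← U.crd_map, ← U.crd_map] at this⟩⟩

theorem inD_of_locally (hR : Presieve.IsSheaf J (R ⋙ forget CommRingCat)) {n k : ℕ} {c : C}
    {S : Sieve c} (hS : S ∈ J c) {x : Vec R n c}
    (h : ∀ ⦃d : C⦄ (f : d ⟶ c), S f → InD k (vres R f x)) : InD k x := fun s =>
  eq_of_locally_eq hR hS fun d f hf => by
    change res R f _ = res R f 0
    rw [map_prod, map_zero]
    exact h f hf s

/-- Charts are closed under neighbours. The local solutions glue because the chart is a subsheaf of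
`M`, and membership in D(n) is local because `R` is a sheaf. -/
theorem exists_of_nbr (hR : Presieve.IsSheaf J (R ⋙ forget CommRingCat))
    (hRKL : (AlgebraObj.self R).IsKL) (hM : Presieve.IsSheaf J M) (U : Chart J R M) {c : C}
    {a : U.domain.obj (op c)} {y : M.obj (op c)} (h : Nbr J R (U.incl.app _ a) y) :
    ∃ b, U.incl.app _ b = y ∧ InD 1 (U.crd b - U.crd a) := by
  obtain ⟨S, hS, H⟩ := h
  have key : ∀ ⦃d : C⦄ (f : d ⟶ c), S f → ∃ b : U.domain.obj (op d),
      U.incl.app _ b = M.map f.op y ∧ InD 1 (U.crd b - vres R f (U.crd a)) := by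
    intro d f hf
    obtain ⟨U', a', b', ha, hb, hab⟩ := H f hf
    rw [← U.incl_map] at ha
    obtain ⟨b, h1, h2⟩ := exists_of_chart hRKL U U' ha hab
    exact ⟨b, h1.trans hb, by rwa [U.crd_map] at h2⟩
  obtain ⟨b, hb⟩ := exists_app_eq_of_locally U.isSheaf hM U.incl U.incl_injective hS y
    fun d f hf => (key f hf).imp fun _ h => h.1
  refine ⟨b, hb, inD_of_locally hR hS fun d f hf => ?_⟩
  obtain ⟨b', h1, h2⟩ := key f hf
  have : b' = U.domain.map f.op b := U.incl_injective _ (by rw [h1, U.incl_map, hb])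
  rwa [map_sub, ← U.crd_map, ← this]

end Chart

end Charts

/-! ### The form in a chart -/

section Forms

variable {J : GrothendieckTopology C} {R : Cᵒᵖ ⥤ CommRingCat.{w}} {M : Cᵒᵖ ⥤ Type w}
  {G : Cᵒᵖ ⥤ GrpCat.{w}}

theorem OneForm.congr (ω : OneForm J R M G) {c : C} {x y x' y' : M.obj (op c)} (hx : x = x')
    (hy : y = y') (h : Nbr J R x y) (h' : Nbr J R x' y') :
    ω.toFun x y h = ω.toFun x' y' h' := by
  subst hx hy
  rfl

open Classical in
/-- A form in the coordinates of a chart. -/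
noncomputable def Chart.formVal (U : Chart J R M) (ω : OneForm J R M G) {W : AlgebraObj R}
    (j : ∀ c : Cᵒᵖ, G.obj c →* W.ring.obj c) {d : C} (r x : Vec R U.dim d) : W.At d :=
  if h : ∃ p : U.domain.obj (op d) × U.domain.obj (op d), U.crd p.1 = r ∧ U.crd p.2 = r + x ∧
      Nbr J R (U.incl.app _ p.1) (U.incl.app _ p.2) then
    j _ (ω.toFun _ _ h.choose_spec.2.2)
  else 0

/-- Coordinates determine points of the chart, so the choice in `formVal` is immaterial. -/
theorem Chart.formVal_eq (U : Chart J R M) (ω : OneForm J R M G) {W : AlgebraObj R}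
    (j : ∀ c : Cᵒᵖ, G.obj c →* W.ring.obj c) {d : C} {r x : Vec R U.dim d}
    {a b : U.domain.obj (op d)} (ha : U.crd a = r) (hb : U.crd b = r + x)
    (h : Nbr J R (U.incl.app _ a) (U.incl.app _ b)) :
    U.formVal ω j r x = j _ (ω.toFun _ _ h) := by
  have hex : ∃ p : U.domain.obj (op d) × U.domain.obj (op d), U.crd p.1 = r ∧
      U.crd p.2 = r + x ∧ Nbr J R (U.incl.app _ p.1) (U.incl.app _ p.2) := ⟨(a, b), ha, hb, h⟩
  rw [formVal, dif_pos hex]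
  refine congrArg (j _) (ω.congr ?_ ?_ _ _)
  · exact congrArg _ (U.crd_injective (hex.choose_spec.1.trans ha.symm))
  · exact congrArg _ (U.crd_injective (hex.choose_spec.2.1.trans hb.symm))

theorem Chart.exists_formVal_eq (U : Chart J R M) (ω : OneForm J R M G) {W : AlgebraObj R}
    (j : ∀ c : Cᵒᵖ, G.obj c →* W.ring.obj c) {d : C} (a : U.domain.obj (op d))
    {x : Vec R U.dim d} (hx : InD 1 x) :
    ∃ (b : U.domain.obj (op d)) (h : Nbr J R (U.incl.app _ a) (U.incl.app _ b)),
      U.crd b = U.crd a + x ∧ U.formVal ω j (U.crd a) x = j _ (ω.toFun _ _ h) := by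
  obtain ⟨b, hb⟩ := U.exists_crd_eq_add a hx
  have h := U.nbr_of_inD (a := a) (b := b) (by rwa [hb, add_sub_cancel_left])
  exact ⟨b, h, hb, U.formVal_eq ω j rfl hb h⟩

/-- A closed form in the coordinates of a chart, as a form with values in an algebra. -/
noncomputable def Chart.coordForm (U : Chart J R M) {ω : OneForm J R M G} (hω : ω.IsClosed)
    {W : AlgebraObj R} (j : ∀ c : Cᵒᵖ, G.obj c →* W.ring.obj c)
    (hj : ∀ ⦃c d : Cᵒᵖ⦄ (f : c ⟶ d) (g : G.obj c),
      j d ((G.map f).hom g) = (W.ring.map f).hom (j c g)) : CoordForm W U.dim where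
  dom d r := ∃ a : U.domain.obj (op d), U.crd a = r
  val d r x := U.formVal ω j r x
  dom_res c d f r := by
    rintro ⟨a, rfl⟩
    exact ⟨U.domain.map f.op a, U.crd_map f a⟩
  dom_add d r x k := by
    rintro ⟨a, rfl⟩ hx
    exact U.exists_crd_eq_add a hx
  val_res c d f r x := by
    rintro ⟨a, rfl⟩ hx
    obtain ⟨b, h, hb, hv⟩ := U.exists_formVal_eq ω j a hx
    rw [hv]
    refine Eq.trans ?_ (hj f.op (ω.toFun _ _ h))
    rw [← ω.naturality]
    have h' := h.map f
    rw [← U.incl_map, ← U.incl_map] at h'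
    rw [U.formVal_eq ω j (U.crd_map f a) (by rw [U.crd_map, hb, map_add]) h']
    exact congrArg (j _) (ω.congr (U.incl_map f a) (U.incl_map f b) _ _)
  val_zero d r := by
    rintro ⟨a, rfl⟩
    have h : Nbr J R (U.incl.app _ a) (U.incl.app _ a) :=
      U.nbr_of_inD (by rw [sub_self]; exact InD.zero 1)
    rw [U.formVal_eq ω j rfl (add_zero _).symm h, ω.refl, map_one]
  val_mul d r x y := by
    rintro ⟨a, rfl⟩ hx hy hxy
    obtain ⟨b, h, hb, hv⟩ := U.exists_formVal_eq ω j a hx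
    obtain ⟨e, h', he, hv'⟩ := U.exists_formVal_eq ω j b hy
    have h'' : Nbr J R (U.incl.app _ a) (U.incl.app _ e) :=
      U.nbr_of_inD (by rwa [he, hb, add_assoc, add_sub_cancel_left])
    rw [hv, ← hb, hv', U.formVal_eq ω j rfl (by rw [he, hb, add_assoc]) h'', ← map_mul,
      hω _ _ _ h h' h'']

/-! ### Integration along paths -/

theorem Nbr.symm {c : C} {x y : M.obj (op c)}
    (h : Nbr J R x y) : Nbr J R y x := by
  obtain ⟨S, hS, H⟩ := h
  refine ⟨S, hS, fun d f hf => ?_⟩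
  obtain ⟨U, a, b, ha, hb, hab⟩ := H f hf
  refine ⟨U, b, a, hb, ha, ?_⟩
  have := InD.neg (x := U.crd b - U.crd a) hab
  rwa [neg_sub] at this

/-- There is a path from `x` to `y` such that the product of the values of `ω` on its steps
is `g`. -/
inductive PathVal (ω : OneForm J R M G) {c : C} (x : M.obj (op c)) :
    M.obj (op c) → G.obj (op c) → Prop
  | nil : PathVal ω x x 1
  | snoc {y z : M.obj (op c)} {g : G.obj (op c)} (p : PathVal ω x y g) (h : Nbr J R y z) :
      PathVal ω x z (g * ω.toFun y z h)

namespace PathVal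

variable {ω : OneForm J R M G} {c : C} {x y z : M.obj (op c)} {g g' : G.obj (op c)}

theorem map (p : PathVal ω x y g) {d : C} (f : d ⟶ c) :
    PathVal ω (M.map f.op x) (M.map f.op y) ((G.map f.op).hom g) := by
  induction p with
  | nil => rw [map_one]; exact nil
  | snoc p h ih =>
    rw [map_mul, ← ω.naturality]
    exact ih.snoc (h.map f)

theorem trans (p : PathVal ω x y g) (q : PathVal ω y z g') : PathVal ω x z (g * g') := by
  induction q with
  | nil => rwa [mul_one]
  | snoc q h ih => rw [← mul_assoc]; exact ih.snoc h

theorem symm (p : PathVal ω x y g) : PathVal ω y x g⁻¹ := by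
  induction p with
  | nil => rw [inv_one]; exact nil
  | snoc p h ih =>
    rw [mul_inv_rev, ← ω.symm _ _ h h.symm]
    have := (nil (ω := ω)).snoc h.symm
    rw [one_mul] at this
    exact this.trans ih

/-- A path starting in a chart never leaves it. The latest step is the head of the list, as
`CoordForm.path` requires. -/
theorem exists_list (hR : Presieve.IsSheaf J (R ⋙ forget CommRingCat))
    (hRKL : (AlgebraObj.self R).IsKL) (hM : Presieve.IsSheaf J M) (hω : ω.IsClosed)
    {W : AlgebraObj R} (j : ∀ c : Cᵒᵖ, G.obj c →* W.ring.obj c)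
    (hj : ∀ ⦃c d : Cᵒᵖ⦄ (f : c ⟶ d) (g : G.obj c),
      j d ((G.map f).hom g) = (W.ring.map f).hom (j c g))
    (U : Chart J R M) (a : U.domain.obj (op c)) (p : PathVal ω (U.incl.app _ a) y g) :
    ∃ (b : U.domain.obj (op c)) (l : List (Vec R U.dim c)), U.incl.app _ b = y ∧
      (∀ v ∈ l, InD 1 v) ∧ U.crd b = U.crd a + l.sum ∧
      (U.coordForm hω j hj).path (U.crd a) 1 l = j _ g := by
  induction p with
  | nil => exact ⟨a, [], rfl, by simp, by simp, by simp [CoordForm.path]⟩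
  | snoc p h ih =>
    obtain ⟨b, l, rfl, hl, hb, hg⟩ := ih
    obtain ⟨e, rfl, he⟩ := U.exists_of_nbr hR hRKL hM h
    refine ⟨e, (U.crd e - U.crd b) :: l, rfl, ?_, ?_, ?_⟩
    · rintro v (_ | ⟨_, hv⟩)
      exacts [he, hl v hv]
    · rw [List.sum_cons, add_left_comm, ← hb, sub_add_cancel]
    · rw [CoordForm.path, hg, one_smul, one_smul, ← hb, map_mul]
      exact congrArg _ (U.formVal_eq ω j rfl (add_sub_cancel _ _).symm h)

/-- The integral of a closed form along a loop is trivial. -/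
theorem eq_one_of_loop (hR : Presieve.IsSheaf J (R ⋙ forget CommRingCat))
    (hRQ : ∀ c : Cᵒᵖ, Nonempty (Algebra ℚ (R.obj c))) (hRKL : (AlgebraObj.self R).IsKL)
    (hM : IsFormalManifold J R M) (hG : Presieve.IsSheaf J (G ⋙ forget GrpCat))
    (hGW : IsMatrixGroup J R G) (hω : ω.IsClosed) (p : PathVal ω x x g) : g = 1 := by
  obtain ⟨W, j, -, hW, hinj, hj⟩ := hGW
  -- Equality in the sheaf `G` is local, so the base point may be taken in a chart.
  obtain ⟨S, hS, H⟩ := hM.covered c x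
  refine eq_of_locally_eq hG hS fun d f hf => ?_
  change (G.map f.op).hom g = (G.map f.op).hom 1
  obtain ⟨U, a, ha⟩ := H f hf
  have q := p.map f
  rw [← ha] at q
  obtain ⟨b, l, hb, hl, hs, hg⟩ := q.exists_list hR hRKL hM.isSheaf hω j hj U a
  -- The loop also closes up inside the chart, so its steps sum to 0.
  obtain rfl := U.incl_injective _ hb
  rw [left_eq_add] at hs
  have hdom : (U.coordForm hω j hj).dom (U.crd b) := ⟨b, rfl⟩
  rw [CoordForm.path_eq_one_of_sum_eq_zero _ hW hRQ hdom hl hs] at hg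
  exact hinj _ (by rw [← hg, map_one, map_one])

/-- The integral of a closed form along a path depends only on the endpoints of the path. -/
theorem unique (hR : Presieve.IsSheaf J (R ⋙ forget CommRingCat))
    (hRQ : ∀ c : Cᵒᵖ, Nonempty (Algebra ℚ (R.obj c))) (hRKL : (AlgebraObj.self R).IsKL)
    (hM : IsFormalManifold J R M) (hG : Presieve.IsSheaf J (G ⋙ forget GrpCat))
    (hGW : IsMatrixGroup J R G) (hω : ω.IsClosed) (p : PathVal ω x y g) (q : PathVal ω x y g') :
    g = g' :=
  mul_inv_eq_one.1 ((p.trans q.symm).eq_one_of_loop hR hRQ hRKL hM hG hGW hω)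

end PathVal

/-! ### Gluing path integrals over the ∞-monad. -/

theorem exists_pathVal_of_path (ω : OneForm J R M G) {c : C} {n : ℕ}
    (p : Fin (n + 1) → M.obj (op c)) (hp : ∀ i : Fin n, Nbr J R (p i.castSucc) (p i.succ))
    (i : Fin (n + 1)) : ∃ g, PathVal ω (p 0) (p i) g := by
  induction i using Fin.induction with
  | zero => exact ⟨1, .nil⟩
  | succ i ih =>
    obtain ⟨g, hg⟩ := ih
    exact ⟨_, hg.snoc (hp i)⟩

theorem inMonad_iff_exists_pathVal (ω : OneForm J R M G) {c : C} {x y : M.obj (op c)} :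
    InMonad J R x y ↔ ∃ S ∈ J c, ∀ ⦃d : C⦄ (f : d ⟶ c), S f →
      ∃ g, PathVal ω (M.map f.op x) (M.map f.op y) g := by
  constructor
  · rintro ⟨S, hS, H⟩
    refine ⟨S, hS, fun d f hf => ?_⟩
    obtain ⟨n, p, h0, h1, hp⟩ := H f hf
    rw [← h0, ← h1]
    exact exists_pathVal_of_path ω p hp _
  · rintro ⟨S, hS, H⟩
    refine ⟨S, hS, fun d f hf => ?_⟩
    obtain ⟨g, hg⟩ := H f hf
    generalize M.map f.op y = z at hg
    induction hg with
    | nil => exact ⟨0, fun _ => M.map f.op x, rfl, rfl, fun i => i.elim0⟩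
    | @snoc y z g _ h ih =>
      obtain ⟨n, p, h0, h1, hp⟩ := ih
      refine ⟨n + 1, Fin.snoc (α := fun _ => M.obj (op d)) p z, ?_, ?_, fun i => ?_⟩
      · rw [← h0]
        exact Fin.snoc_castSucc (α := fun _ => M.obj (op d)) z p 0
      · exact Fin.snoc_last (α := fun _ => M.obj (op d)) z p
      · rw [Fin.snoc_castSucc (α := fun _ => M.obj (op d))]
        induction i using Fin.lastCases with
        | last =>
          rw [Fin.succ_last, Fin.snoc_last (α := fun _ => M.obj (op d)), h1]
          exact h
        | cast i =>
          rw [Fin.succ_castSucc, Fin.snoc_castSucc (α := fun _ => M.obj (op d))]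
          exact hp i

theorem PathVal.inMonad {ω : OneForm J R M G} {c : C} {x y : M.obj (op c)} {g : G.obj (op c)}
    (p : PathVal ω x y g) : InMonad J R x y :=
  (inMonad_iff_exists_pathVal ω).2 ⟨⊤, J.top_mem c, fun _ f _ => ⟨_, p.map f⟩⟩

/-- `g` is the integral of `ω` along all paths from `x` to `y`, at all later stages. -/
def IsIntegral (ω : OneForm J R M G) {c : C} (x y : M.obj (op c)) (g : G.obj (op c)) : Prop :=
  ∀ ⦃d : C⦄ (f : d ⟶ c) (g' : G.obj (op d)), PathVal ω (M.map f.op x) (M.map f.op y) g' →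
    g' = (G.map f.op).hom g

theorem IsIntegral.map {ω : OneForm J R M G} {c : C} {x y : M.obj (op c)} {g : G.obj (op c)}
    (h : IsIntegral ω x y g) {d : C} (f : d ⟶ c) :
    IsIntegral ω (M.map f.op x) (M.map f.op y) ((G.map f.op).hom g) := by
  intro e k g' p
  rw [map_map_apply, map_map_apply] at p
  rw [h _ g' p]
  exact (map_map_apply (groupCarrier G) f k g).symm

theorem IsIntegral.unique {ω : OneForm J R M G} (hG : Presieve.IsSheaf J (G ⋙ forget GrpCat))
    {c : C} {x y : M.obj (op c)} {g g' : G.obj (op c)} (hxy : InMonad J R x y)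
    (h : IsIntegral ω x y g) (h' : IsIntegral ω x y g') : g = g' := by
  obtain ⟨S, hS, H⟩ := (inMonad_iff_exists_pathVal ω).1 hxy
  refine eq_of_locally_eq hG hS fun d f hf => ?_
  obtain ⟨g₀, hg₀⟩ := H f hf
  exact (h f g₀ hg₀).symm.trans (h' f g₀ hg₀)

theorem exists_isIntegral {ω : OneForm J R M G} (hG : Presieve.IsSheaf J (G ⋙ forget GrpCat))
    (huniq : ∀ ⦃c : C⦄ (x y : M.obj (op c)) (g g' : G.obj (op c)),
      PathVal ω x y g → PathVal ω x y g' → g = g')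
    {c : C} {x y : M.obj (op c)} (hxy : InMonad J R x y) : ∃ g, IsIntegral ω x y g := by
  obtain ⟨S, hS, H⟩ := (inMonad_iff_exists_pathVal ω).1 hxy
  -- All stages admitting some path are included, not only those in `S`; thus the glued element
  -- restricts to the integral of every path at every later stage.
  let T : Sieve c :=
    { arrows := fun d f => ∃ g, PathVal ω (M.map f.op x) (M.map f.op y) g
      downward_closed := by
        rintro d e f ⟨g, hg⟩ k
        have := hg.map k
        rw [map_map_apply, map_map_apply] at this
        exact ⟨_, this⟩ }
  have hT : T ∈ J c := J.superset_covering (fun d f hf => H f hf) hS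
  have hT' : ∀ ⦃d : C⦄ (f : d ⟶ c), T f → ∃ g, PathVal ω (M.map f.op x) (M.map f.op y) g :=
    fun d f hf => hf
  choose v hv using hT'
  obtain ⟨g, hg, -⟩ := hG T hT (fun d f hf => v f hf) (by
    intro d₁ d₂ e k₁ k₂ f₁ f₂ h₁ h₂ h12
    have q₁ := (hv f₁ h₁).map k₁
    have q₂ := (hv f₂ h₂).map k₂
    rw [map_map_apply, map_map_apply] at q₁ q₂
    rw [← h12] at q₂
    exact huniq _ _ _ _ q₁ q₂)
  refine ⟨g, fun d f g' p => ?_⟩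
  exact (huniq _ _ _ _ p (hv f ⟨g', p⟩)).trans (hg f ⟨g', p⟩).symm

theorem PathVal.isIntegral {ω : OneForm J R M G}
    (huniq : ∀ ⦃c : C⦄ (x y : M.obj (op c)) (g g' : G.obj (op c)),
      PathVal ω x y g → PathVal ω x y g' → g = g')
    {c : C} {x y : M.obj (op c)} {g : G.obj (op c)} (p : PathVal ω x y g) : IsIntegral ω x y g :=
  fun _ f _ q => huniq _ _ _ _ q (p.map f)

/-- A partial primitive that is `1` at the base point is given by integration. -/
theorem IsPrimitive.eq_of_pathVal {ω : OneForm J R M G} {c : C} {x₀ : M.obj (op c)}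
    {F : StageMap (monad J R x₀) (groupCarrier G)} (hF : IsPrimitive ω F)
    (h1 : (F.toFun (𝟙 c) x₀ (self_mem_monad J R x₀) : G.obj (op c)) = 1)
    {d : C} (f : d ⟶ c) {y : M.obj (op d)} {g : G.obj (op d)}
    (p : PathVal ω (M.map f.op x₀) y g) : F.toFun f y p.inMonad = g := by
  induction p with
  | nil =>
    have h := F.naturality (𝟙 c) f x₀ (self_mem_monad J R x₀)
    simp only [Category.comp_id] at h
    refine h.trans ?_
    refine (congrArg (G.map f.op).hom h1).trans (map_one _)
  | snoc p h ih =>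
    have := hF f _ _ p.inMonad (p.snoc h).inMonad h
    rw [inv_mul_eq_iff_eq_mul] at this
    refine this.trans ?_
    exact congrArg (fun u : G.obj (op d) => u * ω.toFun _ _ h) ih

/-- A closed form whose path integrals are independent of the path has a unique normalized
partial primitive on each `∞`-monad. -/
theorem existsUnique_primitive (hG : Presieve.IsSheaf J (G ⋙ forget GrpCat))
    (ω : OneForm J R M G)
    (huniq : ∀ ⦃c : C⦄ (x y : M.obj (op c)) (g g' : G.obj (op c)),
      PathVal ω x y g → PathVal ω x y g' → g = g') {c : C} (x₀ : M.obj (op c)) :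
    ∃! f : StageMap (monad J R x₀) (groupCarrier G),
      IsPrimitive ω f ∧
      (f.toFun (𝟙 c) x₀ (self_mem_monad J R x₀) : G.obj (op c)) = 1 := by
  choose v hv using fun (d : C) (f : d ⟶ c) (y : M.obj (op d)) (hy : (monad J R x₀).mem f y) =>
    exists_isIntegral hG huniq hy
  refine ⟨⟨fun d f y hy => v d f y hy, fun d e f g y hy => ?_⟩, ⟨?_, ?_⟩, ?_⟩
  · have h := (hv d f y hy).map g
    have hy' := (monad J R x₀).map_mem f g y hy
    rw [map_map_apply] at h
    exact (hv e (g ≫ f) _ hy').unique hG hy' h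
  · intro d f y z hy hz h
    rw [inv_mul_eq_iff_eq_mul]
    -- Locally some path reaches `y`; appending the step from `y` to `z` multiplies its integral by
    -- ω(y, z).
    obtain ⟨S, hS, H⟩ := (inMonad_iff_exists_pathVal ω).1 hy
    refine eq_of_locally_eq hG hS fun e k hk => ?_
    obtain ⟨g, p⟩ := H k hk
    have h1 := hv d f y hy k g p
    have h2 := hv d f z hz k _ (p.snoc (h.map k))
    change (G.map k.op).hom _ = (G.map k.op).hom _
    rw [← h2, h1, ω.naturality, ← map_mul]
  · refine (hv c (𝟙 c) x₀ (self_mem_monad J R x₀)).unique hG (self_mem_monad J R x₀) ?_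
    rw [map_id_apply]
    exact PathVal.nil.isIntegral huniq
  · rintro F ⟨hF, h1⟩
    ext d f y hy
    -- Both primitives are determined by a path to `y`, which exists locally.
    obtain ⟨S, hS, H⟩ := (inMonad_iff_exists_pathVal ω).1 hy
    refine eq_of_locally_eq hG hS fun e k hk => ?_
    obtain ⟨g, p⟩ := H k hk
    refine Eq.trans ?_ (hv d f y hy k g p)
    rw [map_map_apply] at p
    exact (F.naturality f k y hy).symm.trans (hF.eq_of_pathVal h1 (k ≫ f) p)

end Forms

end SDG

theorem corollary1p3 {C : Type u} [Category.{v} C] (J : GrothendieckTopology C)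
    (R : Cᵒᵖ ⥤ CommRingCat.{w}) (hR : Presieve.IsSheaf J (R ⋙ forget CommRingCat))
    (hRQ : ∀ c : Cᵒᵖ, Nonempty (Algebra ℚ (R.obj c)))
    (hRKL : (SDG.AlgebraObj.self R).IsKL)
    (M : Cᵒᵖ ⥤ Type w) (hM : SDG.IsFormalManifold J R M)
    (G : Cᵒᵖ ⥤ GrpCat.{w}) (hG : Presieve.IsSheaf J (G ⋙ forget GrpCat))
    (hGW : SDG.IsMatrixGroup J R G)
    (ω : SDG.OneForm J R M G) (hω : ω.IsClosed)
    (c : C) (x₀ : M.obj (op c)) :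
    ∃! f : SDG.StageMap (SDG.monad J R x₀) (SDG.groupCarrier G),
      SDG.IsPrimitive ω f ∧
      (f.toFun (𝟙 c) x₀ (SDG.self_mem_monad J R x₀) : G.obj (op c)) = 1 := by
  exact SDG.existsUnique_primitive hG ω
    (fun _ _ _ _ _ p q => p.unique hR hRQ hRKL hM hG hGW hω q) x₀
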